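/- Let $A\subseteq\mathbb{R}^2$ be a nonempty finite subset of the Manhattan plane, i.e. of $\mathbb{R}^2$ with the metric $d_1((x_1,y_1),(x_2,y_2))=|x_1-x_2|+|y_1-y_2|$. Consider the following procedure. Step 1. Let $(a,b)$ be the point of $A$ with the smallest ordinate (if there are several such points, the one with the smallest abscissa), and put $\mathrm{SPINE}=\{(a,b)\}$. Step 2. If no point of $A$ has ordinate greater than $b$, go to Step 5. Step 3. Let $R=\{(x,y)\in A : y>b,\ x\ge a\}$ and $L=\{(x,y)\in A : y>b,\ x\le a\}$. i) If $R\neq\emptyset$ and $L\neq\emptyset$, let $t=\min\{\max\{y-b : (x,y)\in R\},\ \max\{y-b : (x,y)\in L\}\}$, add the segment $[(a,b),(a,b+t)]$ to $\mathrm{SPINE}$, and replace $b$ by $b+t$. ii) If $R\neq\emptyset$ and $L=\emptyset$, let $t=\min\{x-a : (x,y)\in R\}$, add the segment $[(a,b),(a+t,b)]$ to $\mathrm{SPINE}$, and replace $a$ by $a+t$. iii) If $L\neq\emptyset$ and $R=\emptyset$, let $t=\min\{a-x : (x,y)\in L\}$, add the segment $[(a-t,b),(a,b)]$ to $\mathrm{SPINE}$,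 and replace $a$ by $a-t$. Step 4. Go to Step 2. Step 5. Join each point of $A$ to some point of $\mathrm{SPINE}$ of the same ordinate by a horizontal segment. Call the union of $\mathrm{SPINE}$ and these segments $\mathrm{SKELETON}$. Step 6. Hatch $\mathrm{SKELETON}$ in the vertical direction, i.e. form $$L_y(\mathrm{SKELETON})=\bigcup_{x_0\in\mathbb{R}}[\mathrm{SKELETON}\cap\{x=x_0\}],$$ where $[X]$ denotes the smallest (possibly empty) segment of the line $x=x_0$ that contains the subset $X$ of that line. Then the procedure is well defined: the loop ends after finitely many passes with a uniquely determined set $\mathrm{SPINE}$, each point of $A$ can be joined to $\mathrm{SPINE}$ by a horizontal segment, and $\mathrm{SKELETON}$ does not depend on the choice of these segments. Moreover $L_y(\mathrm{SKELETON})$, with the metric $d_1$, is isometric to the tight span $T(A)$ of the metric space $(A,d_1)$. Here $T(A)$ is the set of pointwise minimal functions among the functions $f:A\to[0,\infty)$ with $f(p)+f(q)\ge d_1(p,q)$ for all $p,q\in A$, equipped with the metric $d_\infty(f,g)=\sup_{p\in A}|f(p)-g(p)|$. -/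

import Mathlib

/-- The Manhattan plane: `ℝ × ℝ` with the `ℓ¹` distance. -/
abbrev ManhattanPlane : Type := WithLp 1 (ℝ × ℝ)

namespace ManhattanPlane

theorem dist_eq (p q : ManhattanPlane) :
    dist p q = |p.fst - q.fst| + |p.snd - q.snd| := by
  rw [WithLp.prod_dist_eq_of_L1, Real.dist_eq, Real.dist_eq]

/-- The point with abscissa `a` and ordinate `b`. -/
def pt (a b : ℝ) : ManhattanPlane := WithLp.toLp 1 (a, b)

/-- `p` is the point of `A` with the smallest ordinate and, among the points of `A` with that
ordinate, with the smallest abscissa. -/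
def IsStart (A : Set ManhattanPlane) (p : ManhattanPlane) : Prop :=
  p ∈ A ∧ (∀ q ∈ A, p.snd ≤ q.snd) ∧ ∀ q ∈ A, q.snd = p.snd → p.fst ≤ q.fst

/-- The points of `A` that lie strictly higher than `(a, b)` and weakly to the right of it. -/
def upperRight (A : Set ManhattanPlane) (a b : ℝ) : Set ManhattanPlane :=
  {p ∈ A | b < p.snd ∧ a ≤ p.fst}

/-- The points of `A` that lie strictly higher than `(a, b)` and weakly to the left of it. -/
def upperLeft (A : Set ManhattanPlane) (a b : ℝ) : Set ManhattanPlane :=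
  {p ∈ A | b < p.snd ∧ p.fst ≤ a}

/-- `SpineRun A a b S`: after finitely many passes through the loop of the spine algorithm for `A`,
the current values of its variables are `(a, b)` and `S`. -/
inductive SpineRun (A : Set ManhattanPlane) : ℝ → ℝ → Set ManhattanPlane → Prop
  /-- Initialization at the lowest point (the leftmost one in case of a tie). -/
  | start (a b : ℝ) (h : IsStart A (pt a b)) : SpineRun A a b {pt a b}
  /-- Higher points on both sides: go up, to the smaller of the two maximal heights. -/
  | up (a b : ℝ) (S : Set ManhattanPlane) (r l : ℝ) (h : SpineRun A a b S)
      (hR : (upperRight A a b).Nonempty) (hL : (upperLeft A a b).Nonempty)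
      (hr : IsGreatest ((fun p : ManhattanPlane => p.snd - b) '' upperRight A a b) r)
      (hl : IsGreatest ((fun p : ManhattanPlane => p.snd - b) '' upperLeft A a b) l) :
      SpineRun A a (b + min r l) (S ∪ segment ℝ (pt a b) (pt a (b + min r l)))
  /-- Higher points only on the right: go right, to the abscissa of the nearest one. -/
  | right (a b : ℝ) (S : Set ManhattanPlane) (t : ℝ) (h : SpineRun A a b S)
      (hR : (upperRight A a b).Nonempty) (hL : ¬ (upperLeft A a b).Nonempty)
      (ht : IsLeast ((fun p : ManhattanPlane => p.fst - a) '' upperRight A a b) t) :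
      SpineRun A (a + t) b (S ∪ segment ℝ (pt a b) (pt (a + t) b))
  /-- Higher points only on the left: go left, to the abscissa of the nearest one. -/
  | left (a b : ℝ) (S : Set ManhattanPlane) (t : ℝ) (h : SpineRun A a b S)
      (hL : (upperLeft A a b).Nonempty) (hR : ¬ (upperRight A a b).Nonempty)
      (ht : IsLeast ((fun p : ManhattanPlane => a - p.fst) '' upperLeft A a b) t) :
      SpineRun A (a - t) b (S ∪ segment ℝ (pt (a - t) b) (pt a b))

/-- `S` is the output of the spine algorithm: its value at the moment when no point of `A` is
higher than the current point. -/
def IsSpine (A S : Set ManhattanPlane) : Prop :=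
  ∃ a b : ℝ, SpineRun A a b S ∧ ∀ p ∈ A, ¬ b < p.snd

/-- `K` arises from `S` by joining each point `p` of `A` by a horizontal segment to some point
`c p` of `S`. -/
def IsSkeleton (A S K : Set ManhattanPlane) : Prop :=
  ∃ c : ManhattanPlane → ManhattanPlane,
    (∀ p ∈ A, c p ∈ S ∧ (c p).snd = p.snd) ∧ K = S ∪ ⋃ p ∈ A, segment ℝ p (c p)

/-- Hatching in the vertical direction: the intersection of `B` with each vertical line is replaced
by the smallest segment (interval, possibly empty or unbounded) that contains it. -/
def hatchY (B : Set ManhattanPlane) : Set ManhattanPlane :=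
  ⋃ x : ℝ, convexHull ℝ (B ∩ {p | p.fst = x})

end ManhattanPlane

section TightSpan

variable (X : Type*) [MetricSpace X]

/-- The non-negative functions `f` on `X` with `f p + f q ≥ d(p, q)` for all `p`, `q`. -/
def IsAdmissible (f : X → ℝ) : Prop :=
  (∀ p, 0 ≤ f p) ∧ ∀ p q, dist p q ≤ f p + f q

/-- The tight span of `X`: the pointwise minimal admissible functions. -/
def TightSpan : Type _ := {f : X → ℝ // Minimal (IsAdmissible X) f}

variable {X}

namespace TightSpan

theorem le_dist_add (f : TightSpan X) (p q : X) : f.1 p ≤ dist p q + f.1 q := by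
  classical
  by_contra! h
  obtain ⟨f, ⟨h0, h1⟩, hm⟩ := f
  dsimp only at h
  have hle : Function.update f p (dist p q + f q) ≤ f := by
    intro r
    by_cases hr : r = p
    · subst hr; simpa using h.le
    · simp [hr]
  have hadm : IsAdmissible X (Function.update f p (dist p q + f q)) := by
    have hd := dist_nonneg (x := p) (y := q)
    refine ⟨fun r => ?_, fun r s => ?_⟩
    · by_cases hr : r = p
      · subst hr; simpa using add_nonneg hd (h0 q)
      · simpa [hr] using h0 r
    · by_cases hr : r = p <;> by_cases hs : s = p
      · subst hr; subst hs
        simp only [dist_self, Function.update_self]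
        linarith [h0 q]
      · subst hr
        simp only [Function.update_self, Function.update_of_ne hs]
        linarith [h1 q s, dist_triangle r q s]
      · subst hs
        simp only [Function.update_self, Function.update_of_ne hr]
        linarith [h1 r q, dist_triangle r q s, dist_comm s q]
      · simpa [hr, hs] using h1 r s
  have := hm hadm hle p
  simp only [Function.update_self] at this
  linarith

theorem bddAbove (f g : TightSpan X) : BddAbove (Set.range fun p => |f.1 p - g.1 p|) := by
  rcases isEmpty_or_nonempty X with _ | ⟨⟨q⟩⟩
  · simp
  · refine ⟨f.1 q + g.1 q, ?_⟩
    rintro _ ⟨p, rfl⟩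
    rw [abs_le]
    constructor <;>
      linarith [le_dist_add f p q, le_dist_add g p q, f.2.1.2 p q, g.2.1.2 p q]

/-- The tight span carries the supremum metric. -/
noncomputable instance : MetricSpace (TightSpan X) where
  dist f g := ⨆ p, |f.1 p - g.1 p|
  dist_self f := by simp
  dist_comm f g := by simp only [abs_sub_comm]
  dist_triangle f g h := by
    rcases isEmpty_or_nonempty X with _ | _
    · simp
    · exact ciSup_le fun p => (abs_sub_le _ (g.1 p) _).trans
        (add_le_add (le_ciSup (bddAbove f g) p) (le_ciSup (bddAbove g h) p))
  eq_of_dist_eq_zero {f g} h := by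
    apply Subtype.ext
    funext p
    have := le_ciSup (bddAbove f g) p
    have h' : (⨆ p, |f.1 p - g.1 p|) = 0 := h
    rw [h'] at this
    exact sub_eq_zero.1 (abs_nonpos_iff.1 this)

theorem dist_eq (f g : TightSpan X) : dist f g = ⨆ p, |f.1 p - g.1 p| := rfl

end TightSpan

end TightSpan

/-! ### Coordinates, reflection, axis-parallel segments and hatching -/

namespace ManhattanPlane

/-! A point z of the plane gives the function d₁(z, ·) on A, which is minimal as soon as every p ∈ A
has a q ∈ A with z on a geodesic from p to q. The plane is hyperconvex, so every minimal function
dominates, hence equals, such a distance function. So T(A) is the set of these points z modulo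
equality of distance functions, and it remains to find representatives H on which z ↦ d₁(z, ·) is
isometric (`IsTightRealization`, `IsTightRealization.nonempty_isometryEquiv`).

In the ℓ¹ plane z lies between p and q exactly when they lie in opposite closed quadrants at z.
After a reflection, some highest point of A is not to the left of the starting point. If then A lies
in the lower left and upper right quadrants at z, moving z along an antidiagonal leaves all
distances unchanged until a point of A is met; `risingRegion` selects the lower right end of this
slide (`IsRising.isTightRealization`).

The algorithm traces a staircase bounding this region where no point of A lies to the lower right.
It has the closed description `risingSpine`, and the loop invariant is that SPINE is the part of the
staircase weakly to the left of and below the current point (`IsRisingState`). Horizontal sections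
of the staircase are intervals, which makes SKELETON independent of choices, and hatching fills in
exactly `risingRegion` (`IsRising.hatchY_eq`). -/

@[simp] theorem pt_fst (a b : ℝ) : (pt a b).fst = a := rfl

@[simp] theorem pt_snd (a b : ℝ) : (pt a b).snd = b := rfl

theorem ext_coord {p q : ManhattanPlane} (h₁ : p.fst = q.fst) (h₂ : p.snd = q.snd) : p = q := by
  apply (WithLp.equiv 1 (ℝ × ℝ)).injective
  exact Prod.ext h₁ h₂

@[simp] theorem pt_eta (p : ManhattanPlane) : pt p.fst p.snd = p := ext_coord rfl rfl

/-- Reflection in the vertical axis. -/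
def reflect (p : ManhattanPlane) : ManhattanPlane := pt (-p.fst) p.snd

@[simp] theorem reflect_fst (p : ManhattanPlane) : (reflect p).fst = -p.fst := rfl

@[simp] theorem reflect_snd (p : ManhattanPlane) : (reflect p).snd = p.snd := rfl

@[simp] theorem reflect_reflect (p : ManhattanPlane) : reflect (reflect p) = p :=
  ext_coord (by simp) (by simp)

@[simp] theorem dist_reflect (p q : ManhattanPlane) : dist (reflect p) (reflect q) = dist p q := by
  rw [dist_eq, dist_eq, reflect_fst, reflect_fst, reflect_snd, reflect_snd, ← abs_neg (p.fst - q.fst)]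
  congr 2
  ring

theorem reflect_preimage_injective :
    Function.Injective fun S : Set ManhattanPlane => reflect ⁻¹' S := by
  intro S T h
  ext p
  have := congrArg (fun U => reflect p ∈ U) h
  simpa using this

theorem mem_segment_horizontal {p q z : ManhattanPlane} (h : q.snd = p.snd) :
    z ∈ segment ℝ p q ↔ z.snd = p.snd ∧ (p.fst ≤ z.fst ∧ z.fst ≤ q.fst ∨
      q.fst ≤ z.fst ∧ z.fst ≤ p.fst) := by
  constructor
  · rintro ⟨s, t, hs, ht, hst, rfl⟩
    obtain rfl : s = 1 - t := by linarith
    refine ⟨?_, ?_⟩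
    · simp only [WithLp.add_snd, WithLp.smul_snd, smul_eq_mul, h]; ring
    · simp only [WithLp.add_fst, WithLp.smul_fst, smul_eq_mul]
      rcases le_total p.fst q.fst with hpq | hpq
      · left; constructor <;> nlinarith
      · right; constructor <;> nlinarith
  · rintro ⟨h1, h2⟩
    have hz : z.fst ∈ segment ℝ p.fst q.fst := by
      rw [segment_eq_uIcc, Set.mem_uIcc]; exact h2
    obtain ⟨s, t, hs, ht, hst, hx⟩ := hz
    refine ⟨s, t, hs, ht, hst, ext_coord (by simpa using hx) ?_⟩
    simp only [WithLp.add_snd, WithLp.smul_snd, smul_eq_mul, h, h1]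
    rw [← add_mul, hst, one_mul]

theorem mem_segment_vertical {p q z : ManhattanPlane} (h : q.fst = p.fst) (hle : p.snd ≤ q.snd) :
    z ∈ segment ℝ p q ↔ z.fst = p.fst ∧ p.snd ≤ z.snd ∧ z.snd ≤ q.snd := by
  constructor
  · rintro ⟨s, t, hs, ht, hst, rfl⟩
    obtain rfl : s = 1 - t := by linarith
    refine ⟨?_, ?_⟩
    · simp only [WithLp.add_fst, WithLp.smul_fst, smul_eq_mul, h]; ring
    · simp only [WithLp.add_snd, WithLp.smul_snd, smul_eq_mul]
      constructor <;> nlinarith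
  · rintro ⟨h1, h2⟩
    have hz : z.snd ∈ segment ℝ p.snd q.snd := by
      rw [segment_eq_Icc hle]; exact h2
    obtain ⟨s, t, hs, ht, hst, hx⟩ := hz
    refine ⟨s, t, hs, ht, hst, ext_coord ?_ (by simpa using hx)⟩
    simp only [WithLp.add_fst, WithLp.smul_fst, smul_eq_mul, h, h1]
    rw [← add_mul, hst, one_mul]

/-- Vertical hatching fills in between points of the same abscissa. -/
theorem mem_hatchY {B : Set ManhattanPlane} {z : ManhattanPlane} :
    z ∈ hatchY B ↔ (∃ u ∈ B, u.fst = z.fst ∧ u.snd ≤ z.snd) ∧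
      ∃ v ∈ B, v.fst = z.fst ∧ z.snd ≤ v.snd := by
  constructor
  · intro hz
    obtain ⟨x, hx⟩ := Set.mem_iUnion.1 hz
    have hsub : convexHull ℝ (B ∩ {p | p.fst = x}) ⊆
        {w | w.fst = x ∧ (∃ u ∈ B, u.fst = x ∧ u.snd ≤ w.snd) ∧
          ∃ v ∈ B, v.fst = x ∧ w.snd ≤ v.snd} := by
      refine convexHull_min (fun w hw => ⟨hw.2, ⟨w, hw.1, hw.2, le_rfl⟩, w, hw.1, hw.2, le_rfl⟩) ?_
      intro p hp q hq s t hs ht hst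
      obtain ⟨hp, ⟨u, hu, hux, hup⟩, v, hv, hvx, hpv⟩ := hp
      obtain ⟨hq, ⟨u', hu', hux', hup'⟩, v', hv', hvx', hpv'⟩ := hq
      refine ⟨?_, ?_, ?_⟩
      · simp only [WithLp.add_fst, WithLp.smul_fst, smul_eq_mul, hp, hq]
        rw [← add_mul, hst, one_mul]
      · simp only [WithLp.add_snd, WithLp.smul_snd, smul_eq_mul]
        obtain rfl : s = 1 - t := by linarith
        rcases le_total p.snd q.snd with hpq | hpq
        · exact ⟨u, hu, hux, by nlinarith⟩
        · exact ⟨u', hu', hux', by nlinarith⟩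
      · simp only [WithLp.add_snd, WithLp.smul_snd, smul_eq_mul]
        obtain rfl : s = 1 - t := by linarith
        rcases le_total p.snd q.snd with hpq | hpq
        · exact ⟨v', hv', hvx', by nlinarith⟩
        · exact ⟨v, hv, hvx, by nlinarith⟩
    obtain ⟨rfl, h1, h2⟩ := hsub hx
    exact ⟨h1, h2⟩
  · rintro ⟨⟨u, hu, hux, huz⟩, v, hv, hvx, hvz⟩
    have hu' : u ∈ B ∩ {p | p.fst = z.fst} := ⟨hu, hux⟩
    have hv' : v ∈ B ∩ {p | p.fst = z.fst} := ⟨hv, hvx⟩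
    refine Set.mem_iUnion.2 ⟨z.fst, segment_subset_convexHull hu' hv' ?_⟩
    rw [mem_segment_vertical (hvx.trans hux.symm) (huz.trans hvz)]
    exact ⟨hux.symm, huz, hvz⟩

theorem hatchY_reflect (B : Set ManhattanPlane) :
    hatchY (reflect ⁻¹' B) = reflect ⁻¹' hatchY B := by
  ext z
  rw [Set.mem_preimage, mem_hatchY, mem_hatchY]
  refine and_congr ⟨?_, ?_⟩ ⟨?_, ?_⟩ <;>
  · rintro ⟨u, hu, h1, h2⟩
    exact ⟨reflect u, by simpa using hu, by simpa using congrArg Neg.neg h1, h2⟩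

/-! ### Tight realizations -/

/-- `z` realizes a minimal admissible function: each point of `A` is joined to another one by a
geodesic through `z`. -/
def IsBetween (A : Set ManhattanPlane) (z : ManhattanPlane) : Prop :=
  ∀ p ∈ A, ∃ q ∈ A, dist z p + dist z q ≤ dist p q

/-- A subset of the plane that represents the tight span of `A` by distance functions. -/
structure IsTightRealization (A H : Set ManhattanPlane) : Prop where
  isBetween : ∀ z ∈ H, IsBetween A z
  separates : ∀ z ∈ H, ∀ w ∈ H, ∃ p ∈ A, dist z w ≤ |dist z p - dist w p|
  dominates : ∀ z, IsBetween A z → ∃ w ∈ H, ∀ p ∈ A, dist w p ≤ dist z p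

theorem IsBetween.reflect {A : Set ManhattanPlane} {z : ManhattanPlane} (h : IsBetween A z) :
    IsBetween (reflect ⁻¹' A) (reflect z) := by
  intro p hp
  obtain ⟨q, hq, h1⟩ := h _ hp
  refine ⟨ManhattanPlane.reflect q, by simpa using hq, ?_⟩
  rw [← dist_reflect] at h1
  rwa [← dist_reflect z q, ← dist_reflect _ q, reflect_reflect] at h1

theorem IsTightRealization.of_reflect {A H : Set ManhattanPlane}
    (h : IsTightRealization (reflect ⁻¹' A) (reflect ⁻¹' H)) : IsTightRealization A H := by
  have hA : reflect ⁻¹' (reflect ⁻¹' A) = A := by ext; simp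
  refine ⟨fun z hz => ?_, fun z hz w hw => ?_, fun z hz => ?_⟩
  · have := (h.isBetween (reflect z) (by simpa using hz)).reflect
    rwa [hA, reflect_reflect] at this
  · obtain ⟨p, hp, h1⟩ := h.separates (reflect z) (by simpa using hz) (reflect w) (by simpa using hw)
    refine ⟨reflect p, hp, ?_⟩
    rw [← dist_reflect z (reflect p), ← dist_reflect w (reflect p), reflect_reflect]
    rwa [dist_reflect] at h1
  · obtain ⟨w, hw, h1⟩ := h.dominates _ hz.reflect
    refine ⟨reflect w, hw, fun p hp => ?_⟩
    have := h1 (reflect p) (by simpa using hp)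
    rwa [dist_reflect, ← dist_reflect, reflect_reflect] at this

/-- Helly's theorem on the line: pairwise intersecting intervals around `u p` of radius `f p` have a
common point, namely the supremum of their left ends. -/
theorem exists_forall_mem_Icc {X : Type*} [Nonempty X] (u f : X → ℝ)
    (h : ∀ p q, u p - u q ≤ f p + f q) : ∃ c, ∀ p, u p - f p ≤ c ∧ c ≤ u p + f p := by
  refine ⟨⨆ p, (u p - f p), fun p => ⟨?_, ?_⟩⟩
  · refine le_ciSup (f := fun p => u p - f p) ⟨u p + f p, ?_⟩ p
    rintro _ ⟨q, rfl⟩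
    have := h q p
    dsimp only
    linarith
  · refine ciSup_le fun q => ?_
    have := h q p
    linarith

/-- Hyperconvexity of the Manhattan plane. -/
theorem exists_dist_le {A : Set ManhattanPlane} (hne : A.Nonempty) (f : A → ℝ)
    (h : ∀ p q : A, dist p q ≤ f p + f q) : ∃ z : ManhattanPlane, ∀ p : A, dist z p ≤ f p := by
  have := hne.to_subtype
  have hd : ∀ p q : A, |p.1.fst - q.1.fst| + |p.1.snd - q.1.snd| ≤ f p + f q := fun p q => by
    rw [← dist_eq]; exact h p q
  -- In the coordinates x + y and x - y, ℓ¹ balls become squares, so the one-dimensional statement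
  -- applies to each coordinate.
  obtain ⟨c, hc⟩ := exists_forall_mem_Icc (fun p : A => p.1.fst + p.1.snd) f fun p q => by
    have := hd p q
    linarith [le_abs_self (p.1.fst - q.1.fst), le_abs_self (p.1.snd - q.1.snd)]
  obtain ⟨d, hd⟩ := exists_forall_mem_Icc (fun p : A => p.1.fst - p.1.snd) f fun p q => by
    have := hd p q
    linarith [le_abs_self (p.1.fst - q.1.fst), neg_abs_le (p.1.snd - q.1.snd)]
  refine ⟨pt ((c + d) / 2) ((c - d) / 2), fun p => ?_⟩
  obtain ⟨h1, h2⟩ := hc p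
  obtain ⟨h3, h4⟩ := hd p
  rw [dist_eq, pt_fst, pt_snd]
  rcases abs_cases ((c + d) / 2 - p.1.fst) with ⟨h5, _⟩ | ⟨h5, _⟩ <;>
  rcases abs_cases ((c - d) / 2 - p.1.snd) with ⟨h6, _⟩ | ⟨h6, _⟩ <;>
  rw [h5, h6] <;> linarith

theorem IsBetween.minimal {A : Set ManhattanPlane} {z : ManhattanPlane} (h : IsBetween A z) :
    Minimal (IsAdmissible A) fun p : A => dist z p := by
  refine ⟨⟨fun p => dist_nonneg, fun p q => dist_triangle_left p.1 q.1 z⟩, fun g hg hle p => ?_⟩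
  obtain ⟨q, hq, h1⟩ := h p p.2
  have h2 : dist p.1 q ≤ g p + g ⟨q, hq⟩ := hg.2 p ⟨q, hq⟩
  have h3 : g ⟨q, hq⟩ ≤ dist z q := hle ⟨q, hq⟩
  dsimp only
  linarith

end ManhattanPlane

/-- Otherwise the value at `p` could be lowered to the largest of 0 and the numbers `dist p q - f
q`; finiteness makes this maximum attained, so the decrease is strict. -/
theorem TightSpan.exists_add_le {X : Type*} [MetricSpace X] [Finite X] (f : TightSpan X) (p : X) :
    ∃ q, f.1 p + f.1 q ≤ dist p q := by
  classical
  have : Nonempty X := ⟨p⟩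
  by_contra! hlt
  obtain ⟨q, hq⟩ := Finite.exists_max fun q => dist p q - f.1 q
  have hp := hlt p
  rw [dist_self] at hp
  have hadm : IsAdmissible X (Function.update f.1 p (max 0 (dist p q - f.1 q))) := by
    refine ⟨fun r => ?_, fun r s => ?_⟩
    · by_cases hr : r = p
      · subst hr; simp
      · simpa [hr] using f.2.1.1 r
    · by_cases hr : r = p <;> by_cases hs : s = p
      · subst hr; subst hs
        simp only [dist_self, Function.update_self]
        positivity
      · subst hr
        simp only [Function.update_self, Function.update_of_ne hs]
        linarith [hq s, le_max_right 0 (dist r q - f.1 q)]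
      · subst hs
        simp only [Function.update_self, Function.update_of_ne hr]
        linarith [hq r, le_max_right 0 (dist s q - f.1 q), dist_comm r s]
      · simpa [hr, hs] using f.2.1.2 r s
  have hle : Function.update f.1 p (max 0 (dist p q - f.1 q)) ≤ f.1 := by
    intro r
    by_cases hr : r = p
    · subst hr
      rw [Function.update_self]
      exact max_le (f.2.1.1 r) (by linarith [hlt q])
    · simp [hr]
  have := f.2.2 hadm hle p
  rw [Function.update_self] at this
  rcases le_max_iff.1 this with h | h
  · linarith
  · linarith [hlt q]

namespace ManhattanPlane

/-- The isometry is z ↦ d₁(z, ·). For surjectivity, hyperconvexity puts some distance function below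
a minimal `f`, tight pairs of `f` show that its point is between points of A, and `dominates` moves
that point into `H`; minimality of `f` then forces equality. -/
theorem IsTightRealization.nonempty_isometryEquiv {A H : Set ManhattanPlane} (hfin : A.Finite)
    (hne : A.Nonempty) (h : IsTightRealization A H) : Nonempty (H ≃ᵢ TightSpan A) := by
  have := hne.to_subtype
  have := hfin.to_subtype
  let Φ : H → TightSpan A := fun z => ⟨fun p => dist z.1 p, (h.isBetween z z.2).minimal⟩
  have hiso : Isometry Φ := by
    refine Isometry.of_dist_eq fun z w => ?_
    rw [TightSpan.dist_eq]
    refine le_antisymm (ciSup_le fun p => abs_dist_sub_le z.1 w.1 p.1) ?_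
    obtain ⟨p, hp, h1⟩ := h.separates z z.2 w w.2
    exact h1.trans (le_ciSup (TightSpan.bddAbove (Φ z) (Φ w)) ⟨p, hp⟩)
  have hsurj : Function.Surjective Φ := by
    intro f
    obtain ⟨z, hz⟩ := exists_dist_le hne f.1 f.2.1.2
    have hb : IsBetween A z := fun p hp => by
      obtain ⟨q, hq⟩ := f.exists_add_le ⟨p, hp⟩
      exact ⟨q, q.2, (add_le_add (hz ⟨p, hp⟩) (hz q)).trans hq⟩
    obtain ⟨w, hw, hwz⟩ := h.dominates z hb
    have hle : (Φ ⟨w, hw⟩).1 ≤ f.1 := fun p => (hwz p p.2).trans (hz p)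
    exact ⟨⟨w, hw⟩, Subtype.ext (le_antisymm hle (f.2.2 (Φ ⟨w, hw⟩).2.1 hle))⟩
  exact ⟨⟨Equiv.ofBijective Φ ⟨hiso.injective, hsurj⟩, hiso⟩⟩

/-! ### The hatched region when some highest point is on the right of some lowest one -/

/-- The region between the points of `A`, without its part above a rising spine. -/
def risingRegion (A : Set ManhattanPlane) : Set ManhattanPlane :=
  {z | (∃ p ∈ A, p.fst ≤ z.fst ∧ z.snd ≤ p.snd) ∧ (∃ p ∈ A, p.fst ≤ z.fst ∧ p.snd ≤ z.snd) ∧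
    (∃ p ∈ A, z.fst ≤ p.fst ∧ z.snd ≤ p.snd) ∧
    ((∃ p ∈ A, z.fst ≤ p.fst ∧ p.snd ≤ z.snd) ∨ ∀ p ∈ A, p.fst < z.fst → p.snd ≤ z.snd)}

/-- `A` has a lowest point with abscissa `a` and ordinate `b`, and a highest point that is not on
the left of it. -/
structure IsRising (A : Set ManhattanPlane) (a b : ℝ) : Prop where
  mem : pt a b ∈ A
  le_snd : ∀ q ∈ A, b ≤ q.snd
  exists_top : ∃ e ∈ A, (∀ q ∈ A, q.snd ≤ e.snd) ∧ a ≤ e.fst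

/-- The triangle inequality holds in each coordinate, so equality in ℓ¹ forces equality in both. -/
theorem IsBetween.exists_opposite {A : Set ManhattanPlane} {z : ManhattanPlane}
    (h : IsBetween A z) {p : ManhattanPlane} (hp : p ∈ A) : ∃ q ∈ A,
      (p.fst < z.fst → z.fst ≤ q.fst) ∧ (z.fst < p.fst → q.fst ≤ z.fst) ∧
      (p.snd < z.snd → z.snd ≤ q.snd) ∧ (z.snd < p.snd → q.snd ≤ z.snd) := by
  obtain ⟨q, hq, h1⟩ := h p hp
  refine ⟨q, hq, ?_⟩
  rw [dist_eq, dist_eq, dist_eq] at h1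
  have hx := abs_sub_le p.fst z.fst q.fst
  have hy := abs_sub_le p.snd z.snd q.snd
  rw [abs_sub_comm p.fst z.fst] at hx
  rw [abs_sub_comm p.snd z.snd] at hy
  have hx' : |z.fst - p.fst| + |z.fst - q.fst| ≤ |p.fst - q.fst| := by linarith
  have hy' : |z.snd - p.snd| + |z.snd - q.snd| ≤ |p.snd - q.snd| := by linarith
  have key : ∀ s t r : ℝ, |s - t| + |s - r| ≤ |t - r| →
      (t < s → s ≤ r) ∧ (s < t → r ≤ s) := by
    intro s t r hstr
    constructor <;> intro hlt <;> by_contra! hc <;>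
    cases abs_cases (s - t) <;> cases abs_cases (s - r) <;> cases abs_cases (t - r) <;> linarith
  exact ⟨(key _ _ _ hx').1, (key _ _ _ hx').2, (key _ _ _ hy').1, (key _ _ _ hy').2⟩

theorem isBetween_of_exists_opposite {A : Set ManhattanPlane} {z : ManhattanPlane}
    (h : ∀ p ∈ A, ∃ q ∈ A, (p.fst ≤ z.fst ∧ z.fst ≤ q.fst ∨ z.fst ≤ p.fst ∧ q.fst ≤ z.fst) ∧
      (p.snd ≤ z.snd ∧ z.snd ≤ q.snd ∨ z.snd ≤ p.snd ∧ q.snd ≤ z.snd)) : IsBetween A z := by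
  intro p hp
  obtain ⟨q, hq, hx, hy⟩ := h p hp
  refine ⟨q, hq, ?_⟩
  have key : ∀ s t r : ℝ, (t ≤ s ∧ s ≤ r ∨ s ≤ t ∧ r ≤ s) → |s - t| + |s - r| ≤ |t - r| := by
    intro s t r hstr
    rcases hstr with ⟨h1, h2⟩ | ⟨h1, h2⟩ <;>
    cases abs_cases (s - t) <;> cases abs_cases (s - r) <;> cases abs_cases (t - r) <;> linarith
  rw [dist_eq, dist_eq, dist_eq]
  linarith [key _ _ _ hx, key _ _ _ hy]

theorem isBetween_of_mem_risingRegion {A : Set ManhattanPlane} {z : ManhattanPlane}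
    (hz : z ∈ risingRegion A) : IsBetween A z := by
  obtain ⟨⟨nw, hnw, hnw1, hnw2⟩, ⟨sw, hsw, hsw1, hsw2⟩, ⟨ne, hne, hne1, hne2⟩, h⟩ := hz
  refine isBetween_of_exists_opposite fun p hp => ?_
  rcases le_total p.fst z.fst with hx | hx <;> rcases le_total p.snd z.snd with hy | hy
  · exact ⟨ne, hne, .inl ⟨hx, hne1⟩, .inl ⟨hy, hne2⟩⟩
  · rcases h with ⟨se, hse, hse1, hse2⟩ | h
    · exact ⟨se, hse, .inl ⟨hx, hse1⟩, .inr ⟨hy, hse2⟩⟩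
    · rcases hx.lt_or_eq with hlt | heq
      · exact ⟨ne, hne, .inl ⟨hx, hne1⟩, .inl ⟨h p hp hlt, hne2⟩⟩
      -- Here `p` is straight above `z`, so it also counts as upper right and the lower left point
      -- is opposite.
      · exact ⟨sw, hsw, .inr ⟨heq.ge, hsw1⟩, .inr ⟨hy, hsw2⟩⟩
  · exact ⟨nw, hnw, .inr ⟨hx, hnw1⟩, .inl ⟨hy, hnw2⟩⟩
  · exact ⟨sw, hsw, .inr ⟨hx, hsw1⟩, .inr ⟨hy, hsw2⟩⟩

/-- Distances are read off from a point of A beyond the pair: one to the upper right of the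
right-hand point if the pair rises, one to the upper left of the left-hand point if it falls. -/
theorem separates_risingRegion {A : Set ManhattanPlane} {z w : ManhattanPlane}
    (hz : z ∈ risingRegion A) (hw : w ∈ risingRegion A) :
    ∃ p ∈ A, dist z w ≤ |dist z p - dist w p| := by
  wlog hx : z.fst ≤ w.fst generalizing z w
  · obtain ⟨p, hp, h⟩ := this hw hz (le_of_not_ge hx)
    exact ⟨p, hp, by rwa [dist_comm, abs_sub_comm]⟩
  rcases le_total z.snd w.snd with hy | hy
  · obtain ⟨p, hp, h1, h2⟩ := hw.2.2.1
    refine ⟨p, hp, le_trans ?_ (le_abs_self _)⟩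
    rw [dist_eq, dist_eq, dist_eq, abs_of_nonpos (by linarith : z.fst - w.fst ≤ 0),
      abs_of_nonpos (by linarith : z.snd - w.snd ≤ 0),
      abs_of_nonpos (by linarith : z.fst - p.fst ≤ 0),
      abs_of_nonpos (by linarith : z.snd - p.snd ≤ 0),
      abs_of_nonpos (by linarith : w.fst - p.fst ≤ 0),
      abs_of_nonpos (by linarith : w.snd - p.snd ≤ 0)]
    linarith
  · obtain ⟨p, hp, h1, h2⟩ := hz.1
    refine ⟨p, hp, le_trans ?_ (neg_le_abs _)⟩
    rw [dist_eq, dist_eq, dist_eq, abs_of_nonpos (by linarith : z.fst - w.fst ≤ 0),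
      abs_of_nonneg (by linarith : 0 ≤ z.snd - w.snd),
      abs_of_nonneg (by linarith : 0 ≤ z.fst - p.fst),
      abs_of_nonpos (by linarith : z.snd - p.snd ≤ 0),
      abs_of_nonneg (by linarith : 0 ≤ w.fst - p.fst),
      abs_of_nonpos (by linarith : w.snd - p.snd ≤ 0)]
    linarith

/-- A point without points of `A` on its upper left is slid towards the lower right. -/
theorem exists_slide {A : Set ManhattanPlane} (hfin : A.Finite) (hne : A.Nonempty)
    {z : ManhattanPlane} (hnw : ∀ p ∈ A, p.fst ≤ z.fst → p.snd < z.snd)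
    (h : ∀ p ∈ A, z.fst ≤ p.fst ∧ z.snd ≤ p.snd ∨ p.fst ≤ z.fst ∧ p.snd ≤ z.snd)
    (hNE : ∃ p ∈ A, z.fst ≤ p.fst ∧ z.snd ≤ p.snd) (hSW : ∃ p ∈ A, p.fst ≤ z.fst ∧ p.snd ≤ z.snd) :
    ∃ w ∈ risingRegion A, ∀ p ∈ A, dist w p ≤ dist z p := by
  -- The minimum `s` is the length of the slide along (1, -1) after which a point of A, namely `m`,
  -- first enters the closed upper left quadrant.
  obtain ⟨m, hm, hmin⟩ := Set.exists_min_image A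
    (fun p => max (p.fst - z.fst) (z.snd - p.snd)) hfin hne
  set s := max (m.fst - z.fst) (z.snd - m.snd) with hs
  have hs0 : 0 ≤ s := by
    by_contra! hneg
    have h1 := (le_max_left _ _).trans_lt hneg
    have h2 := (le_max_right _ _).trans_lt hneg
    linarith [hnw m hm (by linarith)]
  have h' : ∀ p ∈ A, z.fst ≤ p.fst ∧ z.snd ≤ p.snd ∧ z.fst + s ≤ p.fst ∨
      p.fst ≤ z.fst ∧ p.snd ≤ z.snd ∧ p.snd ≤ z.snd - s := by
    intro p hp
    have h3 : s ≤ max (p.fst - z.fst) (z.snd - p.snd) := hmin p hp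
    rcases h p hp with ⟨h1, h2⟩ | ⟨h1, h2⟩
    · refine .inl ⟨h1, h2, ?_⟩
      rw [max_eq_left (by linarith)] at h3
      linarith
    · refine .inr ⟨h1, h2, ?_⟩
      rw [max_eq_right (by linarith)] at h3
      linarith
  refine ⟨pt (z.fst + s) (z.snd - s), ⟨⟨m, hm, ?_, ?_⟩, ?_, ?_, .inr ?_⟩, ?_⟩
  · rw [pt_fst]; linarith [le_max_left (m.fst - z.fst) (z.snd - m.snd)]
  · rw [pt_snd]; linarith [le_max_right (m.fst - z.fst) (z.snd - m.snd)]
  · obtain ⟨p, hp, h1, h2⟩ := hSW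
    have := hnw p hp h1
    rcases h' p hp with h3 | h3
    · linarith
    · exact ⟨p, hp, by rw [pt_fst]; linarith, by rw [pt_snd]; linarith⟩
  · obtain ⟨p, hp, h1, h2⟩ := hNE
    rcases h' p hp with h3 | h3
    · exact ⟨p, hp, by rw [pt_fst]; linarith, by rw [pt_snd]; linarith⟩
    · linarith [hnw p hp h3.1]
  · intro p hp hlt
    rw [pt_fst] at hlt
    rw [pt_snd]
    rcases h' p hp with h3 | h3 <;> linarith
  · intro p hp
    rw [dist_eq, dist_eq, pt_fst, pt_snd]
    rcases h' p hp with ⟨h1, h2, h3⟩ | ⟨h1, h2, h3⟩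
    · rw [abs_of_nonpos (by linarith : z.fst + s - p.fst ≤ 0),
        abs_of_nonpos (by linarith : z.snd - s - p.snd ≤ 0),
        abs_of_nonpos (by linarith : z.fst - p.fst ≤ 0),
        abs_of_nonpos (by linarith : z.snd - p.snd ≤ 0)]
      linarith
    · rw [abs_of_nonneg (by linarith : 0 ≤ z.fst + s - p.fst),
        abs_of_nonneg (by linarith : 0 ≤ z.snd - s - p.snd),
        abs_of_nonneg (by linarith : 0 ≤ z.fst - p.fst),
        abs_of_nonneg (by linarith : 0 ≤ z.snd - p.snd)]
      linarith

theorem IsRising.isTightRealization {A : Set ManhattanPlane} {a b : ℝ} (hfin : A.Finite)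
    (hA : IsRising A a b) : IsTightRealization A (risingRegion A) := by
  refine ⟨fun z => isBetween_of_mem_risingRegion, fun z hz w => separates_risingRegion hz,
    fun z hz => ?_⟩
  obtain ⟨e, he, htop, hae⟩ := hA.exists_top
  have hbot := hA.le_snd
  have hb : b ≤ z.snd := by
    by_contra! hlt
    obtain ⟨q, hq, -, -, -, h4⟩ := hz.exists_opposite hA.mem
    linarith [h4 hlt, hbot q hq]
  have ht : z.snd ≤ e.snd := by
    by_contra! hlt
    obtain ⟨q, hq, -, -, h4, -⟩ := hz.exists_opposite he
    linarith [h4 hlt, htop q hq]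
  have hright : ∃ p ∈ A, z.fst ≤ p.fst := by
    by_contra! hlt
    obtain ⟨q, hq, h4, -⟩ := hz.exists_opposite he
    linarith [h4 (hlt e he), hlt q hq]
  have hleft : ∃ p ∈ A, p.fst ≤ z.fst := by
    by_contra! hlt
    obtain ⟨q, hq, -, h4, -⟩ := hz.exists_opposite he
    linarith [h4 (hlt e he), hlt q hq]
  by_cases hNW : ∃ p ∈ A, p.fst ≤ z.fst ∧ z.snd ≤ p.snd
  · refine ⟨z, ?_, fun p _ => le_rfl⟩
    by_cases hSE : ∃ p ∈ A, z.fst ≤ p.fst ∧ p.snd ≤ z.snd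
    · refine ⟨hNW, ?_, ?_, .inl hSE⟩
      -- With the lower left quadrant empty, `z` is to the left of both the lowest point and `e`.
      -- The opposite of `e` would be at lower left, unless `z` is at top height; then the upper
      -- left point is itself at lower left. The next case is symmetric.
      · by_contra! hSW
        obtain ⟨p, hp, h1, h2⟩ := hNW
        have ha : z.fst < a := by
          by_contra! hlt
          exact absurd (hSW _ hA.mem hlt) (not_lt.2 hb)
        obtain ⟨q, hq, -, h4, -, h5⟩ := hz.exists_opposite he
        rcases ht.lt_or_eq with hlt | heq
        · linarith [hSW q hq (h4 (by linarith)), h5 hlt]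
        · linarith [hSW p hp h1, htop p hp]
      · by_contra! hNE
        obtain ⟨p, hp, h1, h2⟩ := hSE
        have ha : a < z.fst := by
          by_contra! hlt
          linarith [hNE e he (by linarith)]
        obtain ⟨q, hq, h4, -, h5, -⟩ := hz.exists_opposite hA.mem
        rcases hb.lt_or_eq with hlt | heq
        · linarith [hNE q hq (h4 ha), h5 hlt]
        · linarith [hNE p hp h1, hbot p hp]
    · push Not at hSE
      have ha : a < z.fst := by
        by_contra! hlt
        exact absurd (hSE _ hA.mem hlt) (not_lt.2 hb)
      obtain ⟨p, hp, h1⟩ := hright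
      refine ⟨hNW, ⟨_, hA.mem, ha.le, hb⟩, ⟨p, hp, h1, (hSE p hp h1).le⟩, .inr ?_⟩
      intro q hq hlt
      -- A point strictly to the upper left would need an opposite one in the empty lower right
      -- quadrant.
      by_contra! hc
      obtain ⟨r, hr, h4, -, -, h5⟩ := hz.exists_opposite hq
      linarith [hSE r hr (h4 hlt), h5 hc]
  · push Not at hNW
    have he' : z.fst < e.fst := by
      by_contra! hlt
      linarith [hNW e he hlt]
    obtain ⟨p, hp, h1⟩ := hleft
    refine exists_slide hfin ⟨e, he⟩ hNW (fun q hq => ?_) ⟨e, he, he'.le, ht⟩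
      ⟨p, hp, h1, (hNW p hp h1).le⟩
    rcases le_or_gt q.fst z.fst with hx | hx
    · exact .inr ⟨hx, (hNW q hq hx).le⟩
    · refine .inl ⟨hx.le, ?_⟩
      by_contra! hc
      obtain ⟨r, hr, -, h4, h5, -⟩ := hz.exists_opposite hq
      linarith [hNW r hr (h4 hx), h5 hc]

/-! ### The rising spine -/

/-- The spine of a set with a lowest point `(a, b)` and a highest point not on the left of it. -/
def risingSpine (A : Set ManhattanPlane) (a b : ℝ) : Set ManhattanPlane :=
  {z | a ≤ z.fst ∧ b ≤ z.snd ∧ (∃ p ∈ A, p.fst ≤ z.fst ∧ z.snd ≤ p.snd) ∧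
    (z.fst = a ∨ (∀ p ∈ A, p.fst < z.fst → p.snd ≤ z.snd) ∧
      ∀ p ∈ A, (∀ q ∈ A, q.snd ≤ p.snd) → z.fst ≤ p.fst)}

/-- The state of the spine algorithm on its way along the rising spine. -/
structure IsRisingState (A : Set ManhattanPlane) (a₀ b₀ a b : ℝ) (S : Set ManhattanPlane) :
    Prop where
  mem : pt a b ∈ risingSpine A a₀ b₀
  mem_iff : ∀ z, z ∈ S ↔ z ∈ risingSpine A a₀ b₀ ∧ z.fst ≤ a ∧ z.snd ≤ b

theorem IsRising.start {A : Set ManhattanPlane} {a b : ℝ} (hA : IsRising A a b) :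
    IsRisingState A a b a b {pt a b} := by
  have hm : pt a b ∈ risingSpine A a b := ⟨le_rfl, le_rfl, ⟨_, hA.mem, le_rfl, le_rfl⟩, .inl rfl⟩
  refine ⟨hm, fun z => ⟨?_, fun h => ?_⟩⟩
  · rintro rfl
    exact ⟨hm, le_rfl, le_rfl⟩
  · exact ext_coord (le_antisymm h.2.1 h.1.1) (le_antisymm h.2.2 h.1.2.1)

/-- Nothing of the staircase to the left of abscissa `a` is higher than `b`: its upper left witness
would be strictly to the upper left of the current point. -/
theorem IsRisingState.up {A S S' : Set ManhattanPlane} {a₀ b₀ a b t : ℝ}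
    (h : IsRisingState A a₀ b₀ a b S) (ht : 0 ≤ t) (hL : ∃ p ∈ A, p.fst ≤ a ∧ b + t ≤ p.snd)
    (hS' : ∀ z, z ∈ S' ↔ z ∈ S ∨ z.fst = a ∧ b ≤ z.snd ∧ z.snd ≤ b + t) :
    IsRisingState A a₀ b₀ a (b + t) S' := by
  obtain ⟨⟨h1, h2, h3, h4⟩, hS⟩ := h
  simp only [pt_fst, pt_snd] at h1 h2 h3 h4
  obtain ⟨l, hl, hl1, hl2⟩ := hL
  have hnew : ∀ z : ManhattanPlane, z.fst = a → b ≤ z.snd → z.snd ≤ b + t →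
      z ∈ risingSpine A a₀ b₀ := by
    rintro z rfl hz1 hz2
    refine ⟨h1, h2.trans hz1, ⟨l, hl, hl1, hz2.trans hl2⟩, h4.imp id fun h5 => ⟨?_, h5.2⟩⟩
    exact fun p hp hlt => (h5.1 p hp hlt).trans hz1
  refine ⟨hnew _ rfl (by simpa using ht) le_rfl, fun z => ?_⟩
  rw [hS', hS]
  constructor
  · rintro (⟨hz, hz1, hz2⟩ | ⟨hz, hz1, hz2⟩)
    · exact ⟨hz, hz1, by linarith⟩
    · exact ⟨hnew z hz hz1 hz2, hz.le, hz2⟩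
  · rintro ⟨hz, hz1, hz2⟩
    rcases le_or_gt z.snd b with hzb | hzb
    · exact .inl ⟨hz, hz1, hzb⟩
    · refine .inr ⟨le_antisymm hz1 ?_, hzb.le, hz2⟩
      by_contra! hlt
      obtain ⟨p, hp, hp1, hp2⟩ := hz.2.2.1
      rcases h4 with h4 | h4
      · linarith [hz.1]
      · linarith [h4.1 p hp (by linarith)]

/-- Nothing of the staircase to the right of `a` is lower than `b`: the upper left witness of the
current point would be strictly to its upper left. -/
theorem IsRisingState.right {A S S' : Set ManhattanPlane} {a₀ b₀ a b t : ℝ}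
    (h : IsRisingState A a₀ b₀ a b S) (ht : 0 ≤ t) (hne : ∃ p ∈ A, b < p.snd)
    (hR : ∀ p ∈ A, b < p.snd → a + t ≤ p.fst)
    (hS' : ∀ z, z ∈ S' ↔ z ∈ S ∨ z.snd = b ∧ a ≤ z.fst ∧ z.fst ≤ a + t) :
    IsRisingState A a₀ b₀ (a + t) b S' := by
  obtain ⟨⟨h1, h2, ⟨l, hl, hl1, hl2⟩, -⟩, hS⟩ := h
  simp only [pt_fst, pt_snd] at h1 h2 hl1 hl2
  obtain ⟨r, hr, hr1⟩ := hne
  have hnew : ∀ z : ManhattanPlane, z.snd = b → a ≤ z.fst → z.fst ≤ a + t →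
      z ∈ risingSpine A a₀ b₀ := by
    rintro z rfl hz1 hz2
    refine ⟨h1.trans hz1, h2, ⟨l, hl, hl1.trans hz1, hl2⟩, .inr ⟨fun p hp hlt => ?_,
      fun p hp htop => hz2.trans (hR p hp (hr1.trans_le (htop r hr)))⟩⟩
    by_contra! hc
    linarith [hR p hp hc]
  refine ⟨hnew _ rfl (by simpa using ht) le_rfl, fun z => ?_⟩
  rw [hS', hS]
  constructor
  · rintro (⟨hz, hz1, hz2⟩ | ⟨hz, hz1, hz2⟩)
    · exact ⟨hz, by linarith, hz2⟩
    · exact ⟨hnew z hz hz1 hz2, hz2, hz.le⟩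
  · rintro ⟨hz, hz1, hz2⟩
    rcases le_or_gt z.fst a with hza | hza
    · exact .inl ⟨hz, hza, hz2⟩
    · refine .inr ⟨le_antisymm hz2 ?_, hza.le, hz1⟩
      by_contra! hlt
      rcases hz.2.2.2 with h4 | h4
      · linarith
      · linarith [h4.1 l hl (by linarith)]

/-- The staircase never passes to the right of a highest point, except on the initial vertical line,
where `e` is still on the right. Hence the algorithm never moves left. -/
theorem IsRisingState.exists_right {A S : Set ManhattanPlane} {a₀ b₀ a b : ℝ}
    (hA : IsRising A a₀ b₀) (h : IsRisingState A a₀ b₀ a b S) (hne : ∃ p ∈ A, b < p.snd) :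
    ∃ p ∈ A, b < p.snd ∧ a ≤ p.fst := by
  obtain ⟨e, he, htop, hae⟩ := hA.exists_top
  obtain ⟨p, hp, hbp⟩ := hne
  refine ⟨e, he, hbp.trans_le (htop p hp), ?_⟩
  rcases h.mem.2.2.2 with h4 | h4
  · exact le_of_eq_of_le h4 hae
  · exact h4.2 e he htop

theorem IsRisingState.eq_risingSpine {A S : Set ManhattanPlane} {a₀ b₀ a b : ℝ}
    (h : IsRisingState A a₀ b₀ a b S) (hend : ∀ p ∈ A, ¬ b < p.snd) :
    S = risingSpine A a₀ b₀ := by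
  obtain ⟨⟨h1, h2, ⟨l, hl, hl1, hl2⟩, -⟩, hS⟩ := h
  simp only [pt_fst, pt_snd, not_lt] at h1 h2 hl1 hl2 hend
  ext z
  rw [hS]
  refine ⟨fun hz => hz.1, fun hz => ⟨hz, ?_, ?_⟩⟩
  · by_contra! hlt
    -- At the end `l` is a highest point, and the staircase beyond its initial vertical line stops
    -- at the abscissa of any such point.
    rcases hz.2.2.2 with h4 | h4
    · linarith
    · linarith [h4.2 l hl fun q hq => (hend q hq).trans hl2]
  · obtain ⟨p, hp, -, hp2⟩ := hz.2.2.1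
    exact hp2.trans (hend p hp)

theorem IsStart.unique {A : Set ManhattanPlane} {p q : ManhattanPlane} (hp : IsStart A p)
    (hq : IsStart A q) : p = q := by
  have h : p.snd = q.snd := le_antisymm (hp.2.1 q hq.1) (hq.2.1 p hp.1)
  exact ext_coord (le_antisymm (hp.2.2 q hq.1 h.symm) (hq.2.2 p hp.1 h)) h

theorem SpineRun.isRisingState {A S : Set ManhattanPlane} {a₀ b₀ a b : ℝ}
    (hA : IsRising A a₀ b₀) (h₀ : IsStart A (pt a₀ b₀)) (h : SpineRun A a b S) :
    IsRisingState A a₀ b₀ a b S := by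
  induction h with
  | start a b h =>
    have he := h.unique h₀
    obtain rfl : a = a₀ := congrArg (fun p : ManhattanPlane => p.fst) he
    obtain rfl : b = b₀ := congrArg (fun p : ManhattanPlane => p.snd) he
    exact hA.start
  | up a b S r l h hR hL hr hl ih =>
    obtain ⟨⟨p, ⟨hp, hp1, hp2⟩, rfl⟩, -⟩ := hr
    obtain ⟨⟨q, ⟨hq, hq1, hq2⟩, rfl⟩, -⟩ := hl
    have h0 : 0 ≤ min (p.snd - b) (q.snd - b) := le_min (by linarith) (by linarith)
    refine ih.up h0 ⟨q, hq, hq2, ?_⟩ fun z => ?_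
    · linarith [min_le_right (p.snd - b) (q.snd - b)]
    · dsimp only
      rw [Set.mem_union, mem_segment_vertical (pt_fst a _) (by simp [h0])]
      rfl
  | right a b S t h hR hL ht ih =>
    obtain ⟨⟨p, ⟨hp, hp1, hp2⟩, rfl⟩, hmin⟩ := ht
    have h0 : 0 ≤ p.fst - a := by linarith
    refine ih.right h0 ⟨p, hp, hp1⟩ (fun q hq hbq => ?_) fun z => ?_
    · have haq : a ≤ q.fst := by
        by_contra! hc
        exact hL ⟨q, hq, hbq, hc.le⟩
      have : p.fst - a ≤ q.fst - a := hmin ⟨q, ⟨hq, hbq, haq⟩, rfl⟩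
      dsimp only
      linarith
    · dsimp only
      rw [Set.mem_union, mem_segment_horizontal (p := pt a b) (pt_snd _ b)]
      simp only [pt_fst, pt_snd]
      refine or_congr_right (and_congr_right fun _ => ⟨?_, .inl⟩)
      rintro (h | h)
      · exact h
      · constructor <;> linarith
  | left a b S t h hL hR ht ih =>
    obtain ⟨p, hp, hbp, -⟩ := hL
    obtain ⟨q, hq, hbq, haq⟩ := ih.exists_right hA ⟨p, hp, hbp⟩
    exact absurd ⟨q, hq, hbq, haq⟩ hR

theorem SpineRun.isRisingState_reflect {A S : Set ManhattanPlane} {a₀ b₀ a b : ℝ}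
    (hA : IsRising (reflect ⁻¹' A) (-a₀) b₀) (h₀ : IsStart A (pt a₀ b₀)) (h : SpineRun A a b S) :
    IsRisingState (reflect ⁻¹' A) (-a₀) b₀ (-a) b (reflect ⁻¹' S) := by
  induction h with
  | start a b h =>
    have he := h.unique h₀
    obtain rfl : a = a₀ := congrArg (fun p : ManhattanPlane => p.fst) he
    obtain rfl : b = b₀ := congrArg (fun p : ManhattanPlane => p.snd) he
    convert hA.start using 1
    ext z
    constructor
    · intro hz
      rw [← reflect_reflect z, show reflect z = pt a b from hz]
      rfl
    · rintro rfl
      exact ext_coord (by simp) (by simp)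
  | up a b S r l h hR hL hr hl ih =>
    obtain ⟨⟨p, ⟨hp, hp1, hp2⟩, rfl⟩, -⟩ := hr
    obtain ⟨⟨q, ⟨hq, hq1, hq2⟩, rfl⟩, -⟩ := hl
    have h0 : 0 ≤ min (p.snd - b) (q.snd - b) := le_min (by linarith) (by linarith)
    refine ih.up h0 ⟨reflect p, by simpa using hp, by simpa using hp2, ?_⟩ fun z => ?_
    · rw [reflect_snd]
      linarith [min_le_left (p.snd - b) (q.snd - b)]
    · dsimp only
      rw [Set.mem_preimage, Set.mem_union, mem_segment_vertical (pt_fst a _) (by simp [h0])]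
      simp only [pt_fst, pt_snd, reflect_fst, reflect_snd, Set.mem_preimage, neg_eq_iff_eq_neg]
  | right a b S t h hR hL ht ih =>
    obtain ⟨p, hp, hbp, -⟩ := hR
    obtain ⟨q, hq, hbq, haq⟩ := ih.exists_right hA ⟨reflect p, by simpa using hp, hbp⟩
    refine absurd ⟨reflect q, hq, hbq, ?_⟩ hL
    rw [reflect_fst]
    linarith
  | left a b S t h hL hR ht ih =>
    obtain ⟨⟨p, ⟨hp, hp1, hp2⟩, rfl⟩, hmin⟩ := ht
    have h0 : 0 ≤ a - p.fst := by linarith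
    dsimp only
    rw [neg_sub', sub_neg_eq_add]
    refine ih.right h0 ⟨reflect p, by simpa using hp, hp1⟩ (fun q hq hbq => ?_) fun z => ?_
    · have haq : (reflect q).fst ≤ a := by
        by_contra! hc
        exact hR ⟨reflect q, hq, hbq, hc.le⟩
      have : a - p.fst ≤ a - (reflect q).fst := hmin ⟨reflect q, ⟨hq, hbq, haq⟩, rfl⟩
      rw [reflect_fst] at this
      linarith
    · rw [Set.mem_preimage, Set.mem_union, mem_segment_horizontal (p := pt _ b) (pt_snd a b)]
      simp only [pt_fst, pt_snd, reflect_fst, reflect_snd, Set.mem_preimage]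
      refine or_congr_right (and_congr_right fun _ => ⟨?_, fun h => .inl ?_⟩)
      · rintro (h | h) <;> constructor <;> linarith
      · constructor <;> linarith

/-! ### Termination -/

theorem exists_isStart {A : Set ManhattanPlane} (hfin : A.Finite) (hne : A.Nonempty) :
    ∃ p, IsStart A p := by
  obtain ⟨m, hm, hmin⟩ := Set.exists_min_image A (fun p => p.snd) hfin hne
  obtain ⟨p, ⟨hp, hpm⟩, hpmin⟩ := Set.exists_min_image {p ∈ A | p.snd = m.snd} (fun p => p.fst)
    (hfin.subset (Set.sep_subset _ _)) ⟨m, hm, rfl⟩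
  exact ⟨p, hp, fun q hq => hpm.le.trans (hmin q hq), fun q hq h => hpmin q ⟨hq, h.trans hpm⟩⟩

theorem exists_isGreatest_image {A B : Set ManhattanPlane} (hfin : A.Finite) (hB : B ⊆ A)
    (hne : B.Nonempty) (f : ManhattanPlane → ℝ) : ∃ r, IsGreatest (f '' B) r :=
  ((hfin.subset hB).image f).isCompact.exists_isGreatest (hne.image f)

theorem exists_isLeast_image {A B : Set ManhattanPlane} (hfin : A.Finite) (hB : B ⊆ A)
    (hne : B.Nonempty) (f : ManhattanPlane → ℝ) : ∃ r, IsLeast (f '' B) r :=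
  ((hfin.subset hB).image f).isCompact.exists_isLeast (hne.image f)

/-- As long as there are higher points, at most one horizontal move precedes a vertical one. -/
theorem SpineRun.exists_both {A S : Set ManhattanPlane} {a b : ℝ} (hfin : A.Finite)
    (h : SpineRun A a b S) (hne : ∃ p ∈ A, b < p.snd) : ∃ a' S', SpineRun A a' b S' ∧
      (upperRight A a' b).Nonempty ∧ (upperLeft A a' b).Nonempty := by
  by_cases hR : (upperRight A a b).Nonempty <;> by_cases hL : (upperLeft A a b).Nonempty
  · exact ⟨a, S, h, hR, hL⟩
  · obtain ⟨t, ht⟩ := exists_isLeast_image hfin (Set.sep_subset _ _) hR fun p => p.fst - a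
    refine ⟨_, _, h.right a b S t hR hL ht, ?_⟩
    obtain ⟨⟨p, ⟨hp, hp1, hp2⟩, rfl⟩, -⟩ := ht
    exact ⟨⟨p, hp, hp1, by simp⟩, p, hp, hp1, by simp⟩
  · obtain ⟨t, ht⟩ := exists_isLeast_image hfin (Set.sep_subset _ _) hL fun p => a - p.fst
    refine ⟨_, _, h.left a b S t hL hR ht, ?_⟩
    obtain ⟨⟨p, ⟨hp, hp1, hp2⟩, rfl⟩, -⟩ := ht
    exact ⟨⟨p, hp, hp1, by simp⟩, p, hp, hp1, by simp⟩
  · obtain ⟨p, hp, hbp⟩ := hne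
    rcases le_total a p.fst with hap | hap
    · exact absurd ⟨p, hp, hbp, hap⟩ hR
    · exact absurd ⟨p, hp, hbp, hap⟩ hL

/-- The number of points above the current level decreases with each vertical move: the point
attaining the smaller maximal height is lost. -/
theorem SpineRun.exists_isSpine {A S : Set ManhattanPlane} {a b : ℝ} (hfin : A.Finite)
    (h : SpineRun A a b S) : ∃ S', IsSpine A S' := by
  induction hn : {p ∈ A | b < p.snd}.ncard using Nat.strong_induction_on generalizing a b S with
  | _ n ih =>
    by_cases hne : ∃ p ∈ A, b < p.snd
    · obtain ⟨a', S', h', hR, hL⟩ := h.exists_both hfin hne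
      obtain ⟨r, hr⟩ := exists_isGreatest_image hfin (Set.sep_subset _ _) hR fun p => p.snd - b
      obtain ⟨l, hl⟩ := exists_isGreatest_image hfin (Set.sep_subset _ _) hL fun p => p.snd - b
      have hup := h'.up a' b S' r l hR hL hr hl
      refine ih _ ?_ hup rfl
      rw [← hn]
      obtain ⟨⟨p, ⟨hp, hp1, -⟩, rfl⟩, -⟩ := hr
      obtain ⟨⟨q, ⟨hq, hq1, -⟩, rfl⟩, -⟩ := hl
      dsimp only
      have h0 : 0 < min (p.snd - b) (q.snd - b) := lt_min (by linarith) (by linarith)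
      refine Set.ncard_lt_ncard ⟨fun x hx => ⟨hx.1, by linarith [hx.2]⟩, fun hsub => ?_⟩
        (hfin.subset (Set.sep_subset _ _))
      rcases min_choice (p.snd - b) (q.snd - b) with hm | hm
      · linarith [(hsub ⟨hp, hp1⟩).2]
      · linarith [(hsub ⟨hq, hq1⟩).2]
    · push Not at hne
      exact ⟨S, a, b, h, fun p hp => (hne p hp).not_gt⟩

/-! ### Skeletons -/

/-- Every horizontal line meets `S` in an interval, and those through points of `A` meet it. -/
structure HasLevels (A S : Set ManhattanPlane) : Prop where
  exists_mem : ∀ p ∈ A, ∃ s ∈ S, s.snd = p.snd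
  ordConnected : ∀ u ∈ S, ∀ v ∈ S, ∀ z : ManhattanPlane, z.snd = u.snd → z.snd = v.snd →
    u.fst ≤ z.fst → z.fst ≤ v.fst → z ∈ S

theorem HasLevels.of_reflect {A S : Set ManhattanPlane}
    (h : HasLevels (reflect ⁻¹' A) (reflect ⁻¹' S)) : HasLevels A S := by
  refine ⟨fun p hp => ?_, fun u hu v hv z h1 h2 h3 h4 => ?_⟩
  · obtain ⟨s, hs, h1⟩ := h.exists_mem (reflect p) (by simpa using hp)
    exact ⟨reflect s, hs, h1⟩
  · have := h.ordConnected (reflect v) (by simpa using hv) (reflect u) (by simpa using hu)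
      (reflect z) h2 h1 (by simpa using h4) (by simpa using h3)
    simpa using this

/-- A description without the choice `c`: a segment to another spine point of the same level exceeds
the chosen one only between two spine points, hence inside `S`. -/
theorem IsSkeleton.mem_iff {A S K : Set ManhattanPlane} (h : HasLevels A S)
    (hK : IsSkeleton A S K) (z : ManhattanPlane) :
    z ∈ K ↔ z ∈ S ∨ ∃ p ∈ A, ∃ s ∈ S, s.snd = p.snd ∧ z.snd = p.snd ∧
      (p.fst ≤ z.fst ∧ z.fst ≤ s.fst ∨ s.fst ≤ z.fst ∧ z.fst ≤ p.fst) := by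
  obtain ⟨c, hc, rfl⟩ := hK
  simp only [Set.mem_union, Set.mem_iUnion, exists_prop]
  constructor
  · rintro (hz | ⟨p, hp, hz⟩)
    · exact .inl hz
    · obtain ⟨h1, h2⟩ := hc p hp
      exact .inr ⟨p, hp, c p, h1, h2, (mem_segment_horizontal h2).1 hz⟩
  · rintro (hz | ⟨p, hp, s, hs, hsp, hzp, hz⟩)
    · exact .inl hz
    · obtain ⟨h1, h2⟩ := hc p hp
      by_cases hzc : z ∈ segment ℝ p (c p)
      · exact .inr ⟨p, hp, hzc⟩
      · left
        rw [mem_segment_horizontal h2] at hzc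
        have hzs : z.snd = s.snd := hzp.trans hsp.symm
        have hzc' : z.snd = (c p).snd := hzp.trans h2.symm
        rcases hz with ⟨h3, h4⟩ | ⟨h3, h4⟩
        · refine h.ordConnected (c p) h1 s hs z hzc' hzs ?_ h4
          by_contra! hlt
          exact hzc ⟨hzp, .inl ⟨h3, hlt.le⟩⟩
        · refine h.ordConnected s hs (c p) h1 z hzs hzc' h3 ?_
          by_contra! hlt
          exact hzc ⟨hzp, .inr ⟨hlt.le, h4⟩⟩

theorem HasLevels.existsUnique_isSkeleton {A S : Set ManhattanPlane} (h : HasLevels A S) :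
    ∃! K, IsSkeleton A S K := by
  choose! c hc using h.exists_mem
  refine ⟨_, ⟨c, hc, rfl⟩, fun K hK => ?_⟩
  ext z
  rw [hK.mem_iff h, IsSkeleton.mem_iff h ⟨c, hc, rfl⟩]

theorem IsSkeleton.reflect {A S K : Set ManhattanPlane} (hK : IsSkeleton A S K) :
    IsSkeleton (reflect ⁻¹' A) (reflect ⁻¹' S) (reflect ⁻¹' K) := by
  obtain ⟨c, hc, rfl⟩ := hK
  refine ⟨fun p => ManhattanPlane.reflect (c (ManhattanPlane.reflect p)), fun p hp => ?_, ?_⟩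
  · obtain ⟨h1, h2⟩ := hc _ hp
    exact ⟨by simpa using h1, h2⟩
  · ext z
    simp only [Set.mem_preimage, Set.mem_union, Set.mem_iUnion, exists_prop]
    refine or_congr_right ⟨?_, ?_⟩
    · rintro ⟨p, hp, hz⟩
      refine ⟨ManhattanPlane.reflect p, by simpa using hp, ?_⟩
      obtain ⟨h1, h2⟩ := hc p hp
      rw [mem_segment_horizontal h2, reflect_fst, reflect_snd] at hz
      rw [reflect_reflect, mem_segment_horizontal (by simpa using h2)]
      simp only [reflect_fst, reflect_snd]
      refine ⟨hz.1, hz.2.symm.imp ?_ ?_⟩ <;> rintro ⟨h3, h4⟩ <;> constructor <;> linarith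
    · rintro ⟨p, hp, hz⟩
      refine ⟨ManhattanPlane.reflect p, hp, ?_⟩
      obtain ⟨h1, h2⟩ := hc _ hp
      rw [mem_segment_horizontal (by simpa using h2)] at hz
      rw [mem_segment_horizontal h2]
      simp only [reflect_fst, reflect_snd] at hz ⊢
      refine ⟨hz.1, hz.2.symm.imp ?_ ?_⟩ <;> rintro ⟨h3, h4⟩ <;> constructor <;> linarith

/-! ### Hatching the skeleton of the rising spine -/

theorem exists_mem_risingSpine_le {A : Set ManhattanPlane} {a b : ℝ} (hfin : A.Finite)
    {z : ManhattanPlane} (ha : a ≤ z.fst) (hb : b ≤ z.snd)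
    (h : ∃ p ∈ A, p.fst ≤ z.fst ∧ z.snd ≤ p.snd) :
    ∃ s ∈ risingSpine A a b, s.snd = z.snd ∧ s.fst ≤ z.fst := by
  obtain ⟨p, hp, hp1, hp2⟩ := h
  obtain ⟨m, ⟨hm, hm1⟩, hmin⟩ := Set.exists_min_image {q ∈ A | z.snd ≤ q.snd} (fun q => q.fst)
    (hfin.subset (Set.sep_subset _ _)) ⟨p, hp, hp2⟩
  -- At level `z.snd` the staircase begins at the leftmost abscissa of a point of A at least that
  -- high, cut off at `a`.
  refine ⟨pt (max a m.fst) z.snd, ⟨le_max_left _ _, hb, ⟨m, hm, le_max_right _ _, hm1⟩, ?_⟩, rfl,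
    max_le ha ((hmin p ⟨hp, hp2⟩).trans hp1)⟩
  simp only [pt_fst, pt_snd]
  rcases le_total m.fst a with hma | hma
  · exact .inl (max_eq_left hma)
  · rw [max_eq_right hma]
    refine .inr ⟨fun q hq hlt => ?_, fun q hq htop => hmin q ⟨hq, hm1.trans (htop m hm)⟩⟩
    by_contra! hc
    exact absurd (hmin q ⟨hq, hc.le⟩) hlt.not_ge

theorem mem_risingSpine_of_le {A : Set ManhattanPlane} {a b : ℝ} (hA : IsRising A a b)
    {p : ManhattanPlane} (hp : p ∈ A) (hpa : p.fst ≤ a) : pt a p.snd ∈ risingSpine A a b :=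
  ⟨le_rfl, hA.le_snd p hp, ⟨p, hp, hpa, le_rfl⟩, .inl rfl⟩

theorem IsRising.hasLevels {A : Set ManhattanPlane} {a b : ℝ} (hfin : A.Finite)
    (hA : IsRising A a b) : HasLevels A (risingSpine A a b) := by
  refine ⟨fun p hp => ?_, fun u hu v hv z h1 h2 h3 h4 => ?_⟩
  · rcases le_total p.fst a with h | h
    · exact ⟨_, mem_risingSpine_of_le hA hp h, rfl⟩
    · obtain ⟨s, hs, h1, -⟩ := exists_mem_risingSpine_le hfin h (hA.le_snd p hp)
        ⟨p, hp, le_rfl, le_rfl⟩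
      exact ⟨s, hs, h1⟩
  · obtain ⟨hu1, hu2, ⟨p, hp, hp1, hp2⟩, -⟩ := hu
    obtain ⟨-, -, -, hv⟩ := hv
    refine ⟨hu1.trans h3, h1 ▸ hu2, ⟨p, hp, hp1.trans h3, h1 ▸ hp2⟩, ?_⟩
    rcases hv with hv | ⟨hv1, hv2⟩
    · exact .inl (le_antisymm (h4.trans hv.le) (hu1.trans h3))
    · exact .inr ⟨fun q hq hlt => h2 ▸ hv1 q hq (hlt.trans_le h4),
        fun q hq htop => h4.trans (hv2 q hq htop)⟩

theorem IsRising.risingSpine_subset {A : Set ManhattanPlane} {a b : ℝ} (hA : IsRising A a b) :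
    risingSpine A a b ⊆ risingRegion A := by
  rintro z ⟨h1, h2, h3, h4⟩
  obtain ⟨e, he, htop, hae⟩ := hA.exists_top
  refine ⟨h3, ⟨_, hA.mem, h1, h2⟩, ⟨e, he, ?_, ?_⟩, ?_⟩
  · rcases h4 with h4 | h4
    · exact h4.le.trans hae
    · exact h4.2 e he htop
  · obtain ⟨p, hp, -, hp2⟩ := h3
    exact hp2.trans (htop p hp)
  · rcases h4 with h4 | h4
    · exact .inl ⟨_, hA.mem, h4.le, h2⟩
    · exact .inr h4.1

/-- On a segment from `p` to the spine, `p` supplies the witnesses in the two quadrants on its own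
side, and the spine point passes on the remaining conditions. -/
theorem IsRising.skeleton_subset {A K : Set ManhattanPlane} {a b : ℝ} (hfin : A.Finite)
    (hA : IsRising A a b) (hK : IsSkeleton A (risingSpine A a b) K) : K ⊆ risingRegion A := by
  intro z hz
  rw [hK.mem_iff (hA.hasLevels hfin)] at hz
  rcases hz with hz | ⟨p, hp, s, hs, hsp, hzp, hz⟩
  · exact hA.risingSpine_subset hz
  · obtain ⟨⟨nw, hnw, hnw1, hnw2⟩, ⟨sw, hsw, hsw1, hsw2⟩, ⟨ne, hne, hne1, hne2⟩, h⟩ :=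
      hA.risingSpine_subset hs
    have hzs : z.snd = s.snd := hzp.trans hsp.symm
    rcases hz with ⟨h3, h4⟩ | ⟨h3, h4⟩
    · refine ⟨⟨p, hp, h3, hzp.le⟩, ⟨p, hp, h3, hzp.ge⟩,
        ⟨ne, hne, h4.trans hne1, hzs.le.trans hne2⟩, h.imp ?_ fun h q hq hlt => ?_⟩
      · rintro ⟨se, hse, hse1, hse2⟩
        exact ⟨se, hse, h4.trans hse1, hse2.trans hzs.ge⟩
      · exact (h q hq (hlt.trans_le h4)).trans hzs.ge
    · exact ⟨⟨nw, hnw, hnw1.trans h3, hzs.le.trans hnw2⟩, ⟨sw, hsw, hsw1.trans h3, hsw2.trans hzs.ge⟩,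
        ⟨p, hp, h4, hzp.le⟩, .inl ⟨p, hp, h4, hzp.ge⟩⟩

theorem IsRising.hatchY_eq {A K : Set ManhattanPlane} {a b : ℝ} (hfin : A.Finite)
    (hA : IsRising A a b) (hK : IsSkeleton A (risingSpine A a b) K) :
    hatchY K = risingRegion A := by
  have hsub := hA.skeleton_subset hfin hK
  have hmem := hK.mem_iff (hA.hasLevels hfin)
  ext z
  rw [mem_hatchY]
  constructor
  · rintro ⟨⟨u, hu, hux, huz⟩, v, hv, hvx, hvz⟩
    -- The conditions stable under moving up come from the lower point `u`, those stable under
    -- moving down from the upper point `v`.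
    obtain ⟨-, ⟨sw, hsw, hsw1, hsw2⟩, -, h⟩ := hsub hu
    obtain ⟨⟨nw, hnw, hnw1, hnw2⟩, -, ⟨ne, hne, hne1, hne2⟩, -⟩ := hsub hv
    refine ⟨⟨nw, hnw, hnw1.trans hvx.le, hvz.trans hnw2⟩, ⟨sw, hsw, hsw1.trans hux.le, hsw2.trans huz⟩,
      ⟨ne, hne, hvx.ge.trans hne1, hvz.trans hne2⟩, h.imp ?_ fun h q hq hlt => ?_⟩
    · rintro ⟨se, hse, hse1, hse2⟩
      exact ⟨se, hse, hux.ge.trans hse1, hse2.trans huz⟩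
    · exact (h q hq (hlt.trans_le hux.ge)).trans huz
  · rintro ⟨⟨nw, hnw, hnw1, hnw2⟩, ⟨sw, hsw, hsw1, hsw2⟩, ⟨ne, hne, hne1, hne2⟩, h⟩
    -- On either side of `a`, the horizontal segment from a suitable point of A to the spine crosses
    -- the vertical line through `z`.
    have hleft : ∀ p ∈ A, p.fst ≤ z.fst → z.fst ≤ a → pt z.fst p.snd ∈ K := fun p hp h1 h2 =>
      (hmem _).2 (.inr ⟨p, hp, _, mem_risingSpine_of_le hA hp (h1.trans h2), rfl, rfl,
        .inl ⟨h1, h2⟩⟩)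
    have hright : ∀ p ∈ A, z.fst ≤ p.fst → a ≤ z.fst → (∃ q ∈ A, q.fst ≤ z.fst ∧ p.snd ≤ q.snd) →
        pt z.fst p.snd ∈ K := by
      intro p hp h1 h2 h3
      obtain ⟨s, hs, hsp, hsz⟩ := exists_mem_risingSpine_le (z := pt z.fst p.snd) hfin h2
        (hA.le_snd p hp) h3
      exact (hmem _).2 (.inr ⟨p, hp, s, hs, hsp, rfl, .inr ⟨hsz, h1⟩⟩)
    rcases le_total z.fst a with ha | ha
    · exact ⟨⟨_, hleft sw hsw hsw1 ha, rfl, hsw2⟩, _, hleft nw hnw hnw1 ha, rfl, hnw2⟩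
    constructor
    · by_cases hSE : ∃ p ∈ A, z.fst ≤ p.fst ∧ p.snd ≤ z.snd
      · obtain ⟨p, hp, hp1, hp2⟩ := hSE
        exact ⟨_, hright p hp hp1 ha ⟨nw, hnw, hnw1, hp2.trans hnw2⟩, rfl, hp2⟩
      · have h' := h.resolve_left hSE
        refine ⟨z, (hmem z).2 (.inl ⟨ha, (hA.le_snd sw hsw).trans hsw2, ⟨nw, hnw, hnw1, hnw2⟩,
          .inr ⟨h', fun t ht htop => ?_⟩⟩), rfl, le_rfl⟩
        -- A highest point strictly to the left would be no higher than `z`, so the upper right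
        -- witness would also be at lower right.
        by_contra! hlt
        exact hSE ⟨ne, hne, hne1, (htop ne hne).trans (h' t ht hlt)⟩
    · obtain ⟨m, ⟨hm, hm1⟩, hmax⟩ := Set.exists_max_image {q ∈ A | q.fst ≤ z.fst}
        (fun q => q.snd) (hfin.subset (Set.sep_subset _ _)) ⟨nw, hnw, hnw1⟩
      -- If the staircase reaches the abscissa of `z`, it does so at the height of the highest point
      -- weakly to the left. Otherwise a highest point is strictly to the left, and the segment
      -- through the upper right witness passes above `z`.
      by_cases ht : ∀ p ∈ A, (∀ q ∈ A, q.snd ≤ p.snd) → z.fst ≤ p.fst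
      · refine ⟨pt z.fst m.snd, (hmem _).2 (.inl ⟨ha, hA.le_snd m hm, ⟨m, hm, hm1, le_rfl⟩,
          .inr ⟨fun q hq hlt => hmax q ⟨hq, hlt.le⟩, ht⟩⟩), rfl, hnw2.trans (hmax nw ⟨hnw, hnw1⟩)⟩
      · push Not at ht
        obtain ⟨t, ht, htop, hlt⟩ := ht
        exact ⟨_, hright ne hne hne1 ha ⟨t, ht, hlt.le, htop ne hne⟩, rfl, hne2⟩

/-! ### Reduction to the rising case and conclusion -/

/-- The output of the spine algorithm is unique, has the required horizontal sections, and leads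
to a realization of the tight span. -/
theorem spine_correct {A : Set ManhattanPlane} (hfin : A.Finite) (hne : A.Nonempty) :
    ∃ E, (∀ S, IsSpine A S → S = E) ∧ HasLevels A E ∧
      ∀ K, IsSkeleton A E K → IsTightRealization A (hatchY K) := by
  obtain ⟨p, hp⟩ := exists_isStart hfin hne
  obtain ⟨e, he, htop⟩ := Set.exists_max_image A (fun p => p.snd) hfin hne
  rcases le_total p.fst e.fst with hpe | hpe
  · have hA : IsRising A p.fst p.snd := ⟨by simpa using hp.1, hp.2.1, e, he, htop, hpe⟩
    refine ⟨risingSpine A p.fst p.snd, ?_, hA.hasLevels hfin, fun K hK => ?_⟩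
    · rintro S ⟨a, b, hS, hend⟩
      exact (hS.isRisingState hA (by simpa using hp)).eq_risingSpine hend
    · rw [hA.hatchY_eq hfin hK]
      exact hA.isTightRealization hfin
  -- The starting point need not be leftmost after reflection, but `IsRising` asks only for some
  -- lowest point.
  · have hA : IsRising (reflect ⁻¹' A) (-p.fst) p.snd := by
      refine ⟨?_, fun q hq => hp.2.1 (reflect q) hq, reflect e, by simpa using he,
        fun q hq => htop (reflect q) hq,
        by simpa using hpe⟩
      rw [Set.mem_preimage, show reflect (pt (-p.fst) p.snd) = p from
        ext_coord (neg_neg _) rfl]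
      exact hp.1
    have hfin' : (reflect ⁻¹' A).Finite :=
      hfin.preimage (Function.LeftInverse.injective reflect_reflect).injOn
    have hE : reflect ⁻¹' (reflect ⁻¹' risingSpine (reflect ⁻¹' A) (-p.fst) p.snd) =
        risingSpine (reflect ⁻¹' A) (-p.fst) p.snd := by ext; simp
    refine ⟨reflect ⁻¹' risingSpine (reflect ⁻¹' A) (-p.fst) p.snd, ?_, ?_, fun K hK => ?_⟩
    · rintro S ⟨a, b, hS, hend⟩
      apply reflect_preimage_injective
      exact ((hS.isRisingState_reflect hA (by simpa using hp)).eq_risingSpine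
        fun q hq => hend (reflect q) hq).trans hE.symm
    · apply HasLevels.of_reflect
      rw [hE]
      exact hA.hasLevels hfin'
    · apply IsTightRealization.of_reflect
      have hK' := hK.reflect
      rw [hE] at hK'
      rw [← hatchY_reflect, hA.hatchY_eq hfin' hK']
      exact hA.isTightRealization hfin'

end ManhattanPlane

theorem theorem2 (A : Set ManhattanPlane) (hfin : A.Finite) (hne : A.Nonempty) :
    (∃! S : Set ManhattanPlane, ManhattanPlane.IsSpine A S) ∧
    ∀ S : Set ManhattanPlane, ManhattanPlane.IsSpine A S →
      (∃! K : Set ManhattanPlane, ManhattanPlane.IsSkeleton A S K) ∧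
      ∀ K : Set ManhattanPlane, ManhattanPlane.IsSkeleton A S K →
        Nonempty (ManhattanPlane.hatchY K ≃ᵢ TightSpan A) := by
  obtain ⟨E, huniq, hlev, hreal⟩ := ManhattanPlane.spine_correct hfin hne
  refine ⟨?_, fun S hS => ?_⟩
  · obtain ⟨p, hp⟩ := ManhattanPlane.exists_isStart hfin hne
    obtain ⟨S, hS⟩ := (ManhattanPlane.SpineRun.start p.fst p.snd (by simpa using hp)).exists_isSpine
      hfin
    exact ⟨S, hS, fun S' hS' => (huniq S' hS').trans (huniq S hS).symm⟩
  · obtain rfl := huniq S hS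
    exact ⟨hlev.existsUnique_isSkeleton,
      fun K hK => (hreal K hK).nonempty_isometryEquiv hfin hne⟩
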